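/- **Theorem (liveness of Flexible MinBFT).** Consider $N$ replicas $0,\dots,N-1$, at most $f$ of which are faulty (Byzantine), where $N\ge 2f+1$, and a replicated service given by a deterministic state machine. Suppose that the correct replicas run the protocol Flexible MinBFT below, with commit quorums of size $f+1$, view change quorums of size $N-f$, and $q$ messages $\mathsf{ReqViewChange}$ needed to trigger a view change, where $f+1\le q\le N-f$. Suppose that timing is partially synchronous. Then every operation requested by a correct client eventually completes, that is, the client receives replies with one and the same result from $f+1$ distinct replicas. *Model.* Time is discrete. There are an unknown time $\mathrm{GST}$ and an unknown bound $\Delta$ such that whatever a correct node sends, or holds in its retransmission buffer, at time $t$ reaches each correct addressee by time $\max(t,\mathrm{GST})+\Delta$. Apart from this, messages may be delayed, reordered and duplicated. Local computation takes no time of its own. Faulty replicas and clients behave arbitrarily, but cannot forge signatures of correct replicas or clients. Each replica has a trusted component (USIG) that certifies messages with successive counter values; not even a faulty replica obtains certificates for two messages with the same counter value. A correct client signs its requests $(c,\mathit{id},\mathit{op})$, sends them to all replicas, uses increasing identifiers, and makes a new request only after the previous one has completed. *Protocol.* The primary of view $v$ is replica $v \bmod N$; all replicas start in view $0$. $\mathsf{Prepare}$,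 $\mathsf{Commit}$, $\mathsf{ViewChange}$ and $\mathsf{NewView}$ messages are USIG-certified. Those of a given replica are processed in the order of their counter values without gaps, and only if they are valid: they belong to the view in which their sender is (determined by its $\mathsf{ViewChange}$ messages), proposals come from the primary of that view, and what they refer to has been processed as well. Correct replicas retransmit to all replicas the messages they hold, both their own and those received from others, so that lagging replicas can catch up. 1. *Prepare.* In view $v$ (if $v>0$, after its $\mathsf{NewView}$), the primary certifies a $\mathsf{Prepare}$ for each request $m$ that it holds, unless the sequence proposed in the view already has a command of the same client with the same or a larger identifier. The counter value is the sequence number of $m$. 2. *Commit.* A replica in view $v$ certifies a $\mathsf{Commit}$ for every valid proposal of view $v$, that is, for its $\mathsf{NewView}$ (if $v>0$) and its $\mathsf{Prepare}$ messages. 3. *Execute.* Commits of $f+1$ replicas for a proposal form a commit certificate. A replica that holds certificates for a proposal of a view and for all earlier proposals of that view executes the proposed sequence of commands up to that point, as far as it has not done so. It skips a command if an earlier command of the sequence comes from the same client and has the same or a larger identifier. It replies to the client of each executed command with the result. 4. *Request a view change.* A replica in view $v$ sends $\mathsf{ReqViewChange}$ for view $v+1$ if it has been in view $v$ for time $\tau(v)$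 and, moreover, either has no valid $\mathsf{NewView}$ of view $v>0$, or has held for time $\tau(v)$ a request that its executed sequence does not cover (by a command of the same client with the same or a larger identifier). The timeouts satisfy $\tau(v)\to\infty$ as $v\to\infty$ and are otherwise arbitrary. 5. *Enter a view.* A replica in a view below $v'$ that holds $\mathsf{ReqViewChange}$ messages for $v'$ from $q$ replicas enters view $v'$ and certifies a $\mathsf{ViewChange}$ message with the log $O$ of all the messages it has certified so far. (Logs are not truncated: the last stable checkpoint is the initial state.) 6. *New view.* The primary of view $v>0$, once in that view, certifies one $\mathsf{NewView}$ message with valid $\mathsf{ViewChange}$ messages for $v$ from at least $N-f$ replicas and a sequence $S$ of commands, which begins the proposed sequence of the view. $S$ is the sequence proposed up to the latest proposal (highest view, then highest counter value) that some of the logs $O$ show as prepared by its primary or committed; it is empty if there is none. A correct replica takes every action that is enabled without delay. -/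

import Mathlib

open Filter

namespace FlexMinBFT

/-- A client command: the issuing client, the identifier the client gave it, and the operation. -/
structure Command (Client Op : Type*) where
  client : Client
  id : ℕ
  op : Op

/-- The replicated service: a deterministic state machine. -/
structure Service (Op Res St : Type*) where
  start : St
  apply : St → Op → St × Res

/-- Bodies of the messages that carry a certificate of the trusted component (USIG).  Sender and
counter value are part of the certificate, see `Msg.certified`.
* `prepare v m`: the primary of view `v` proposes command `m`; its sequence number is the counter
  value of the certificate.
* `commit v k`: the sender accepts the proposal that the primary of view `v` certified with
  counter value `k`.
* `viewChange v O`: the sender moves to view `v`; `O` lists the messages it certified before.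
* `newView v V S`: the primary of view `v` opens it; `V` is the new view certificate, which lists
  the senders and the logs `O` of the `viewChange` messages used, and `S` is the sequence of
  prepared or committed commands computed from them. -/
inductive Body (N : ℕ) (Client Op : Type*) where
  | prepare (v : ℕ) (m : Command Client Op)
  | commit (v k : ℕ)
  | viewChange (v : ℕ) (O : List (Body N Client Op))
  | newView (v : ℕ) (V : List (Fin N × List (Body N Client Op))) (S : List (Command Client Op))

/-- Messages.  `certified r k b` is the body `b` with the certificate of the USIG of replica `r`
for counter value `k`; counter values start at `0`.  The others are signed by their author. -/
inductive Msg (N : ℕ) (Client Op Res : Type*) where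
  | request (m : Command Client Op)
  | certified (r : Fin N) (k : ℕ) (b : Body N Client Op)
  | reqViewChange (r : Fin N) (v v' : ℕ)
  | reply (r : Fin N) (c : Client) (id : ℕ) (res : Res)

/-- The replica that signed a message (none for requests, which are signed by clients). -/
def Msg.author {N : ℕ} {Client Op Res : Type*} : Msg N Client Op Res → Option (Fin N)
  | .request _ => none
  | .certified r _ _ => some r
  | .reqViewChange r _ _ => some r
  | .reply r _ _ _ => some r

/-- The primary of view `v` is replica `v mod N`. -/
def primary (N : ℕ) [NeZero N] (v : ℕ) : Fin N := Fin.ofNat N v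

section Service

variable {Client Op Res St : Type*}

/-- `m.id ≤ V_req[m.client]` for a replica that has gone through the sequence `h`: the sequence
has a command of the same client with the same or a larger identifier. -/
def Stale (h : List (Command Client Op)) (m : Command Client Op) : Prop :=
  ∃ m' ∈ h, m'.client = m.client ∧ m.id ≤ m'.id

open Classical in
/-- Service state after executing the commands `h'`, coming after `h`, from state `x`; stale
commands are skipped. -/
noncomputable def runFrom (svc : Service Op Res St) :
    List (Command Client Op) → St → List (Command Client Op) → St
  | _, x, [] => x
  | h, x, m :: h' =>
      runFrom svc (h ++ [m]) (if Stale h m then x else (svc.apply x m.op).1) h'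

/-- Service state after executing the sequence `h`. -/
noncomputable def run (svc : Service Op Res St) (h : List (Command Client Op)) : St :=
  runFrom svc [] svc.start h

/-- Along the sequence `h` the command `m` is executed (not skipped), with result `res`. -/
def Executes (svc : Service Op Res St) (h : List (Command Client Op)) (m : Command Client Op)
    (res : Res) : Prop :=
  ∃ h₁ h₂, h = h₁ ++ m :: h₂ ∧ ¬ Stale h₁ m ∧ res = (svc.apply (run svc h₁) m.op).2

end Service

section Messages

variable {N : ℕ} {Client Op : Type*}

/-- The view in which a replica is after certifying the messages `l`. -/
def curView (l : List (Body N Client Op)) : ℕ :=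
  l.foldl (fun w b => match b with | .viewChange v _ => v | _ => w) 0

/-- The sequence of commands proposed for view `v` by a primary that certified the messages `l`:
the sequence of its `newView` message, followed by the commands it prepared. -/
def histOf (v : ℕ) (l : List (Body N Client Op)) : List (Command Client Op) :=
  l.foldl (fun h b => match b with
    | .newView v' _ S => if v' = v then S else h
    | .prepare v' m => if v' = v then h ++ [m] else h
    | _ => h) []

/-- The messages by which a primary proposes (an extension of) the sequence of view `v`. -/
def IsProposal (v : ℕ) (b : Body N Client Op) : Prop :=
  (∃ m, b = .prepare v m) ∨ ∃ V S, b = .newView v V S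

/-- The log `O` shows that its owner prepared (as the primary) or committed the proposal of
view `w` with counter value `k`. -/
def Vouches (O : List (Body N Client Op)) (w k : ℕ) : Prop :=
  Body.commit w k ∈ O ∨ ∃ b, O[k]? = some b ∧ IsProposal w b

end Messages

section Protocol

variable {N : ℕ} [NeZero N] {Client Op Res St : Type*}

/-- `Accepted f K r l`: a replica that holds the messages `K` has processed and found valid the
messages `l`, which are the first ones certified by the USIG of `r`.  Messages of `r` are
processed strictly in the order of their counter values.

A `newView` needs `viewChange` messages from `N - f` replicas.  Its sequence `S` is the one
proposed up to the latest proposal (highest view, then highest counter value) that some log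
in these messages shows as prepared or committed, and empty if the logs show none. -/
inductive Accepted (f : ℕ) (K : Set (Msg N Client Op Res)) :
    Fin N → List (Body N Client Op) → Prop where
  | nil (r : Fin N) : Accepted f K r []
  | prepare {r : Fin N} {l : List (Body N Client Op)} {v : ℕ} {m : Command Client Op} :
      Accepted f K r l →
      .certified r l.length (.prepare v m) ∈ K →
      .request m ∈ K →
      r = primary N v → curView l = v →
      (v = 0 ∨ ∃ V S, Body.newView v V S ∈ l) →
      Accepted f K r (l ++ [.prepare v m])
  | commit {r : Fin N} {l l' : List (Body N Client Op)} {b : Body N Client Op} {v k : ℕ} :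
      Accepted f K r l →
      .certified r l.length (.commit v k) ∈ K →
      curView l = v →
      Accepted f K (primary N v) (l' ++ [b]) → l'.length = k → IsProposal v b →
      Accepted f K r (l ++ [.commit v k])
  | viewChange {r : Fin N} {l : List (Body N Client Op)} {v : ℕ} :
      Accepted f K r l →
      .certified r l.length (.viewChange v l) ∈ K →
      curView l < v →
      Accepted f K r (l ++ [.viewChange v l])
  | newViewEmpty {r : Fin N} {l : List (Body N Client Op)} {v : ℕ}
      {V : List (Fin N × List (Body N Client Op))} :
      Accepted f K r l →
      .certified r l.length (.newView v V []) ∈ K →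
      r = primary N v → curView l = v → (¬ ∃ V' S', Body.newView v V' S' ∈ l) →
      N ≤ V.length + f → (V.map Prod.fst).Nodup →
      (∀ e ∈ V, Accepted f K e.1 (e.2 ++ [.viewChange v e.2])) →
      (∀ e ∈ V, ∀ w k, ¬ Vouches e.2 w k) →
      Accepted f K r (l ++ [.newView v V []])
  | newView {r : Fin N} {l l' : List (Body N Client Op)} {v w k : ℕ}
      {V : List (Fin N × List (Body N Client Op))} :
      Accepted f K r l →
      .certified r l.length (.newView v V (histOf w l')) ∈ K →
      r = primary N v → curView l = v → (¬ ∃ V' S', Body.newView v V' S' ∈ l) →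
      N ≤ V.length + f → (V.map Prod.fst).Nodup →
      (∀ e ∈ V, Accepted f K e.1 (e.2 ++ [.viewChange v e.2])) →
      (∃ e ∈ V, Vouches e.2 w k) →
      (∀ e ∈ V, ∀ w' k', Vouches e.2 w' k' → w' < w ∨ (w' = w ∧ k' ≤ k)) →
      Accepted f K (primary N w) l' → l'.length = k + 1 →
      Accepted f K r (l ++ [.newView v V (histOf w l')])

/-- A commit certificate: accepted `commit` messages of `f + 1` replicas for the proposal with
counter value `k` of view `v`. -/
def Certificate (f : ℕ) (K : Set (Msg N Client Op Res)) (v k : ℕ) : Prop :=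
  ∃ Q : Finset (Fin N), f + 1 ≤ Q.card ∧ ∀ r ∈ Q, ∃ l, Accepted f K r (l ++ [.commit v k])

/-- `h` is the sequence proposed in some view up to some proposal, and that proposal and all
earlier ones of the view have commit certificates. -/
def Decided (f : ℕ) (K : Set (Msg N Client Op Res)) (h : List (Command Client Op)) : Prop :=
  ∃ v l b, Accepted f K (primary N v) (l ++ [b]) ∧ IsProposal v b ∧
    (∀ k b', (l ++ [b])[k]? = some b' → IsProposal v b' → Certificate f K v k) ∧
    h = histOf v (l ++ [b])

/-- State of a replica: the messages it holds (received or generated) with the tick at which it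
obtained them, the messages certified by its own USIG, its view, the tick at which it entered
this view, and the sequence of commands it has gone through in execution. -/
structure Replica (N : ℕ) (Client Op Res : Type*) where
  held : List (ℕ × Msg N Client Op Res)
  own : List (Body N Client Op)
  view : ℕ
  since : ℕ
  hist : List (Command Client Op)

namespace Replica

def initial : Replica N Client Op Res := ⟨[], [], 0, 0, []⟩

def msgs (s : Replica N Client Op Res) : Set (Msg N Client Op Res) :=
  {x | ∃ t, (t, x) ∈ s.held}

def hold (s : Replica N Client Op Res) (t : ℕ) (x : Msg N Client Op Res) :
    Replica N Client Op Res :=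
  { s with held := s.held ++ [(t, x)] }

def receive (s : Replica N Client Op Res) (t : ℕ) (inbox : List (Msg N Client Op Res)) :
    Replica N Client Op Res :=
  { s with held := s.held ++ inbox.map (fun x => (t, x)) }

/-- Replica `i` obtains a certificate for `b`, with its next counter value, from its USIG. -/
def issue (s : Replica N Client Op Res) (i : Fin N) (t : ℕ) (b : Body N Client Op) :
    Replica N Client Op Res :=
  { s.hold t (.certified i s.own.length b) with own := s.own ++ [b] }

/-- Replica `i` itself would accept `b` as its next certified message. -/
def MayIssue (f : ℕ) (s : Replica N Client Op Res) (i : Fin N) (b : Body N Client Op) : Prop :=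
  Accepted f (insert (.certified i s.own.length b) s.msgs) i (s.own ++ [b])

/-- The replica takes part in its current view: it is view `0`, or a valid `newView` arrived. -/
def Active (f : ℕ) (s : Replica N Client Op Res) : Prop :=
  s.view = 0 ∨
    ∃ l V S, Accepted f s.msgs (primary N s.view) l ∧ Body.newView s.view V S ∈ l

end Replica

/-- Parameters: `f` is the number of tolerated faults, `q` the number of `reqViewChange` messages
that trigger a view change, and `timeout v` the length of the timers in view `v`. -/
structure Params where
  f : ℕ
  q : ℕ
  timeout : ℕ → ℕ

/-- The actions of a correct replica `i` at tick `t`. -/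
inductive Act (P : Params) (svc : Service Op Res St) (i : Fin N) (t : ℕ) :
    Replica N Client Op Res → Replica N Client Op Res → Prop where
  /-- The primary proposes a requested command. -/
  | prepare (s : Replica N Client Op Res) (m : Command Client Op) :
      .request m ∈ s.msgs → ¬ Stale (histOf s.view s.own) m →
      s.MayIssue P.f i (.prepare s.view m) →
      Act P svc i t s (s.issue i t (.prepare s.view m))
  /-- A replica votes for a proposal of its current view. -/
  | commit (s : Replica N Client Op Res) (k : ℕ) :
      Body.commit s.view k ∉ s.own →
      s.MayIssue P.f i (.commit s.view k) →
      Act P svc i t s (s.issue i t (.commit s.view k))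
  /-- A replica executes commands once they have commit certificates. -/
  | execute (s : Replica N Client Op Res) (h : List (Command Client Op)) :
      Decided P.f s.msgs h → s.hist <+: h → s.hist ≠ h →
      Act P svc i t s { s with hist := h }
  /-- A replica replies to the client of an executed command. -/
  | reply (s : Replica N Client Op Res) (m : Command Client Op) (res : Res) :
      Executes svc s.hist m res →
      .reply i m.client m.id res ∉ s.msgs →
      Act P svc i t s (s.hold t (.reply i m.client m.id res))
  /-- A timer expires: the view has not been opened in time, or a request has been known for too
  long without being executed. -/
  | timeout (s : Replica N Client Op Res) :
      s.since + P.timeout s.view ≤ t →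
      (¬ s.Active P.f ∨ ∃ t₀ m, (t₀, Msg.request m) ∈ s.held ∧
        t₀ + P.timeout s.view ≤ t ∧ ¬ Stale s.hist m) →
      .reqViewChange i s.view (s.view + 1) ∉ s.msgs →
      Act P svc i t s (s.hold t (.reqViewChange i s.view (s.view + 1)))
  /-- `q` replicas request view `v`: the replica moves to it and says so. -/
  | enterView (s : Replica N Client Op Res) (v : ℕ) (Q : Finset (Fin N)) :
      s.view < v → P.q ≤ Q.card →
      (∀ r ∈ Q, ∃ w, .reqViewChange r w v ∈ s.msgs) →
      Act P svc i t s { s.issue i t (.viewChange v s.own) with view := v, since := t }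
  /-- The primary opens its view. -/
  | newView (s : Replica N Client Op Res) (V : List (Fin N × List (Body N Client Op)))
      (S : List (Command Client Op)) :
      s.MayIssue P.f i (.newView s.view V S) →
      Act P svc i t s (s.issue i t (.newView s.view V S))

/-- Tick `t` of a correct replica: it receives its inbox and acts until nothing is left to do. -/
def Tick (P : Params) (svc : Service Op Res St) (i : Fin N) (t : ℕ)
    (inbox : List (Msg N Client Op Res)) (s s' : Replica N Client Op Res) : Prop :=
  Relation.ReflTransGen (Act P svc i t) (s.receive t inbox) s' ∧ ∀ s'', ¬ Act P svc i t s' s''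

end Protocol

section Execution

variable {N : ℕ} [NeZero N] {Client Op Res St : Type*}

/-- What happens in a run.  `replica t i` is the state of replica `i` before tick `t`,
`inbox t i` and `clientInbox t c` the messages that arrive at tick `t`, and `submits t m` says
that the client of `m` requests `m` at tick `t`.  The states of faulty replicas are
irrelevant. -/
structure Execution (N : ℕ) (Client Op Res : Type*) where
  replica : ℕ → Fin N → Replica N Client Op Res
  inbox : ℕ → Fin N → List (Msg N Client Op Res)
  clientInbox : ℕ → Client → List (Msg N Client Op Res)
  submits : ℕ → Command Client Op → Prop

/-- By tick `t` the client of `m` has received replies with the same result from `f + 1`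
replicas. -/
def Completed (f : ℕ) (X : Execution N Client Op Res) (m : Command Client Op) (t : ℕ) : Prop :=
  ∃ res, ∃ Q : Finset (Fin N), f + 1 ≤ Q.card ∧
    ∀ r ∈ Q, ∃ t' ≤ t, .reply r m.client m.id res ∈ X.clientInbox t' m.client

def CorrectReplica (P : Params) (svc : Service Op Res St) (X : Execution N Client Op Res)
    (i : Fin N) : Prop :=
  X.replica 0 i = Replica.initial ∧
    ∀ t, Tick P svc i t (X.inbox t i) (X.replica t i) (X.replica (t + 1) i)

/-- A correct client uses increasing identifiers, and requests one operation at a time. -/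
def CorrectClient (f : ℕ) (X : Execution N Client Op Res) (c : Client) : Prop :=
  ∀ t t' m m', m.client = c → m'.client = c → X.submits t m → X.submits t' m' →
    (t = t' → m = m') ∧ (t < t' → m.id < m'.id ∧ Completed f X m t')

/-- The cryptographic assumptions, for the correct replicas `R` and the correct clients `C`:
nobody forges a signature of a correct replica or client, and no USIG, be it the one of a faulty
replica, certifies two messages with the same counter value. -/
structure Authentic (X : Execution N Client Op Res) (R : Finset (Fin N)) (C : Set Client) :
    Prop where
  replica : ∀ t, ∀ j ∈ R, ∀ x ∈ X.inbox t j, ∀ i ∈ R, x.author = some i →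
    x ∈ (X.replica t i).msgs
  reply : ∀ t, ∀ c ∈ C, ∀ x ∈ X.clientInbox t c, ∀ i ∈ R, x.author = some i →
    x ∈ (X.replica t i).msgs
  client : ∀ t, ∀ j ∈ R, ∀ m, .request m ∈ X.inbox t j → m.client ∈ C →
    ∃ t' ≤ t, X.submits t' m
  usig : ∀ t t', ∀ j ∈ R, ∀ j' ∈ R, ∀ r k b b', .certified r k b ∈ X.inbox t j →
    .certified r k b' ∈ X.inbox t' j' → b = b'

/-- Partial synchrony: from some time on, communication between correct nodes takes a bounded
time; neither that time nor the bound is known to the protocol.  Messages may be lost, reordered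
and duplicated, but correct nodes keep what they sent or forward in a buffer and retransmit it,
so that eventually it arrives.  Replicas retransmit all the messages that they hold. -/
def PartiallySynchronous (X : Execution N Client Op Res) (R : Finset (Fin N)) (C : Set Client) :
    Prop :=
  ∃ GST Δ : ℕ,
    (∀ t, ∀ i ∈ R, ∀ x ∈ (X.replica t i).msgs, ∀ j ∈ R,
      ∃ t' ≤ max t GST + Δ, x ∈ X.inbox t' j) ∧
    (∀ t, ∀ i ∈ R, ∀ r, ∀ c ∈ C, ∀ id res, .reply r c id res ∈ (X.replica t i).msgs →
      ∃ t' ≤ max t GST + Δ, .reply r c id res ∈ X.clientInbox t' c) ∧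
    (∀ t m, m.client ∈ C → X.submits t m → ∀ j ∈ R,
      ∃ t' ≤ max t GST + Δ, .request m ∈ X.inbox t' j)

end Execution

end FlexMinBFT

/-! A correct replica executes a command once `f + 1` replicas have committed it and all its
predecessors in the view.  Any `N - f` logs collected by a later primary include one of a committer,
so its `newView` extends the committed sequence, by induction on views; hence all sequences decided
by correct replicas are comparable.  This needs only that a USIG never certifies two messages with
the same counter value.

Suppose that no correct replica ever executes the last request of some correct client.  The timers
then push the correct replicas through all views.  Since at least one of the `q ≥ f + 1` requests
for a view change is sent by a correct replica, and only after its timeout, nobody can hurry them.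
So consider a late view with a correct primary, whose timeout exceeds a few message delays.  All
correct replicas enter it within one delay of each other and stay in it long enough for the primary
to collect `N - f` logs, and for its proposals and then their commits to reach everyone.  At that
point the request is executed after all. -/

namespace FlexMinBFT

section Logs

variable {N : ℕ} {Client Op : Type*} {l : List (Body N Client Op)} {b : Body N Client Op} {v : ℕ}

theorem exists_append_prefix_of_mem {α : Type*} {l : List α} {a : α} (h : a ∈ l) :
    ∃ l', l' ++ [a] <+: l := by
  obtain ⟨l₁, l₂, rfl⟩ := List.append_of_mem h
  exact ⟨l₁, l₂, by simp⟩

theorem exists_append_prefix_of_getElem? {α : Type*} {l : List α} {k : ℕ} {a : α}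
    (h : l[k]? = some a) : ∃ l', l' ++ [a] <+: l ∧ l'.length = k := by
  refine ⟨l.take k, ?_, List.length_take_of_le (List.getElem?_eq_some_iff.1 h).1.le⟩
  have : l.take k ++ [a] = l.take (k + 1) := by simp [List.take_add_one, h]
  exact this ▸ List.take_prefix _ _

theorem curView_append_singleton (l : List (Body N Client Op)) (b : Body N Client Op) :
    curView (l ++ [b]) = match b with
      | .viewChange v _ => v
      | _ => curView l := by
  simp [curView]

theorem histOf_append_singleton (v : ℕ) (l : List (Body N Client Op)) (b : Body N Client Op) :
    histOf v (l ++ [b]) = match b with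
      | .newView v' _ S => if v' = v then S else histOf v l
      | .prepare v' m => if v' = v then histOf v l ++ [m] else histOf v l
      | _ => histOf v l := by
  simp only [histOf, List.foldl_append, List.foldl_cons, List.foldl_nil]

theorem histOf_append_of_not_isProposal (hb : ¬ IsProposal v b) :
    histOf v (l ++ [b]) = histOf v l := by
  cases b <;> simp_all [histOf_append_singleton, IsProposal]

theorem exists_last_proposal (l : List (Body N Client Op)) (h : ∃ b ∈ l, IsProposal v b) :
    ∃ l' b, l' ++ [b] <+: l ∧ IsProposal v b ∧ histOf v (l' ++ [b]) = histOf v l := by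
  induction l using List.reverseRecOn with
  | nil => simp at h
  | append_singleton l b ih =>
    by_cases hb : IsProposal v b
    · exact ⟨l, b, List.prefix_rfl, hb, rfl⟩
    · obtain ⟨l', b', hl', hb', hhist⟩ := ih (by simpa [or_and_right, exists_or, hb] using h)
      exact ⟨l', b', hl'.trans (List.prefix_append _ _), hb',
        hhist.trans (histOf_append_of_not_isProposal hb).symm⟩

theorem IsProposal.view_unique {w : ℕ} (hv : IsProposal v b) (hw : IsProposal w b) : v = w := by
  rcases hv with ⟨m, rfl⟩ | ⟨V, S, rfl⟩ <;> simpa [IsProposal] using hw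

theorem finite_vouches (O : List (Body N Client Op)) :
    {p : ℕ × ℕ | Vouches O p.1 p.2}.Finite := by
  have hcommit : {p : ℕ × ℕ | Body.commit p.1 p.2 ∈ O}.Finite :=
    O.finite_toSet.preimage (f := fun p : ℕ × ℕ => Body.commit p.1 p.2)
      fun p _ p' _ h => by injection h with h₁ h₂; exact Prod.ext h₁ h₂
  have hpropose : {p : ℕ × ℕ | ∃ b, O[p.2]? = some b ∧ IsProposal p.1 b}.Finite := by
    refine Set.Finite.of_injOn (f := Prod.snd) (t := Set.Iio O.length) ?_ ?_ (Set.finite_Iio _)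
    · rintro p ⟨b, hb, -⟩
      exact (List.getElem?_eq_some_iff.1 hb).1
    · rintro ⟨w, k⟩ ⟨b, hb, hw⟩ ⟨w', k'⟩ ⟨b', hb', hw'⟩ rfl
      obtain rfl : b = b' := Option.some.inj (hb.symm.trans hb')
      exact Prod.ext (hw.view_unique hw') rfl
  exact hcommit.union hpropose

/-- The proposal of view `w` with counter value `k` is the latest one (highest view, then highest
counter value) that the logs in `V` show as prepared or committed. -/
def IsLatestVouched (V : List (Fin N × List (Body N Client Op))) (w k : ℕ) : Prop :=
  (∃ e ∈ V, Vouches e.2 w k) ∧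
    ∀ e ∈ V, ∀ w' k', Vouches e.2 w' k' → w' < w ∨ (w' = w ∧ k' ≤ k)

theorem exists_isLatestVouched {V : List (Fin N × List (Body N Client Op))}
    (h : ∃ e ∈ V, ∃ w k, Vouches e.2 w k) : ∃ w k, IsLatestVouched V w k := by
  have hfin : {p : ℕ × ℕ | ∃ e ∈ V, Vouches e.2 p.1 p.2}.Finite := by
    convert V.finite_toSet.biUnion fun e _ => finite_vouches e.2 using 1
    ext p
    simp
  obtain ⟨e, he, w, k, hwk⟩ := h
  obtain ⟨p, hp, hmax⟩ := Set.exists_max_image _ toLex hfin ⟨(w, k), e, he, hwk⟩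
  exact ⟨p.1, p.2, hp, fun e' he' w' k' h' =>
    Prod.Lex.toLex_le_toLex.1 (hmax (w', k') ⟨e', he', h'⟩)⟩

theorem exists_mem_mem_of_lt_card_add_card {Q R : Finset (Fin N)} (h : N < Q.card + R.card) :
    ∃ r ∈ Q, r ∈ R := by
  obtain ⟨r, hr⟩ := Finset.inter_nonempty_of_card_lt_card_add_card Q.subset_univ R.subset_univ
    (by rwa [Finset.card_fin])
  exact ⟨r, Finset.mem_inter.1 hr⟩

end Logs

section Accepted

variable {N : ℕ} [NeZero N] {Client Op Res : Type*} {f : ℕ} {K K' : Set (Msg N Client Op Res)}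
  {r : Fin N} {l l' : List (Body N Client Op)} {b : Body N Client Op} {v w k : ℕ}
  {V : List (Fin N × List (Body N Client Op))} {S : List (Command Client Op)}

theorem Accepted.mono (hK : K ⊆ K') (h : Accepted f K r l) : Accepted f K' r l := by
  induction h with
  | nil r => exact .nil r
  | prepare _ hc hm hr hv hopen ih => exact .prepare ih (hK hc) (hK hm) hr hv hopen
  | commit _ hc hv _ hk hb ih ihb => exact .commit ih (hK hc) hv ihb hk hb
  | viewChange _ hc hv ih => exact .viewChange ih (hK hc) hv
  | newViewEmpty _ hc hr hv hno hcard hnd _ hvouch ih ihV =>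
    exact .newViewEmpty ih (hK hc) hr hv hno hcard hnd ihV hvouch
  | newView _ hc hr hv hno hcard hnd _ hvouch hmax _ hlen ih ihV ihl =>
    exact .newView ih (hK hc) hr hv hno hcard hnd ihV hvouch hmax ihl hlen

/-- `V` is a new view certificate for view `v`: valid `viewChange` messages of `N - f` replicas. -/
structure NewViewCertificate (f : ℕ) (K : Set (Msg N Client Op Res)) (v : ℕ)
    (V : List (Fin N × List (Body N Client Op))) : Prop where
  card : N ≤ V.length + f
  nodup : (V.map Prod.fst).Nodup
  accepted : ∀ e ∈ V, Accepted f K e.1 (e.2 ++ [.viewChange v e.2])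

/-- `S` is the sequence that a `newView` message with certificate `V` has to start from. -/
def CarriedOver (f : ℕ) (K : Set (Msg N Client Op Res))
    (V : List (Fin N × List (Body N Client Op))) (S : List (Command Client Op)) : Prop :=
  (S = [] ∧ ∀ e ∈ V, ∀ w k, ¬ Vouches e.2 w k) ∨
    ∃ w k l, IsLatestVouched V w k ∧ Accepted f K (primary N w) l ∧ l.length = k + 1 ∧
      S = histOf w l

/-- What makes `b` a valid message of `r` after the messages `l`: the conditions of `Accepted`
other than those on `l` and on the certificate of `b`. -/
def Valid (f : ℕ) (K : Set (Msg N Client Op Res)) (r : Fin N) (l : List (Body N Client Op)) :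
    Body N Client Op → Prop
  | .prepare v m => .request m ∈ K ∧ r = primary N v ∧ curView l = v ∧
      (v = 0 ∨ ∃ V S, Body.newView v V S ∈ l)
  | .commit v k => curView l = v ∧
      ∃ l' b, Accepted f K (primary N v) (l' ++ [b]) ∧ l'.length = k ∧ IsProposal v b
  | .viewChange v O => O = l ∧ curView l < v
  | .newView v V S => r = primary N v ∧ curView l = v ∧ (¬ ∃ V' S', Body.newView v V' S' ∈ l) ∧
      NewViewCertificate f K v V ∧ CarriedOver f K V S

theorem Accepted.append_singleton (h : Accepted f K r l) (hc : .certified r l.length b ∈ K)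
    (hb : Valid f K r l b) : Accepted f K r (l ++ [b]) := by
  cases b with
  | prepare v m =>
    obtain ⟨hm, hr, hv, hopen⟩ := hb
    exact .prepare h hc hm hr hv hopen
  | commit v k =>
    obtain ⟨hv, l', b, hl', hk, hb⟩ := hb
    exact .commit h hc hv hl' hk hb
  | viewChange v O =>
    obtain ⟨rfl, hv⟩ := hb
    exact .viewChange h hc hv
  | newView v V S =>
    obtain ⟨hr, hv, hno, ⟨hcard, hnd, hV⟩, ⟨rfl, hvouch⟩ |
      ⟨w, k, l', ⟨hvouch, hmax⟩, hl', hk, rfl⟩⟩ := hb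
    · exact .newViewEmpty h hc hr hv hno hcard hnd hV hvouch
    · exact .newView h hc hr hv hno hcard hnd hV hvouch hmax hl' hk

theorem accepted_append_singleton :
    Accepted f K r (l ++ [b]) ↔
      Accepted f K r l ∧ .certified r l.length b ∈ K ∧ Valid f K r l b := by
  refine ⟨fun h => ?_, fun ⟨h, hc, hb⟩ => h.append_singleton hc hb⟩
  generalize hL : l ++ [b] = L at h
  cases h with
  | nil r => simp at hL
  | prepare h hc hm hr hv hopen =>
    obtain ⟨rfl, rfl⟩ := List.append_singleton_inj.1 hL
    exact ⟨h, hc, hm, hr, hv, hopen⟩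
  | commit h hc hv hl' hk hb =>
    obtain ⟨rfl, rfl⟩ := List.append_singleton_inj.1 hL
    exact ⟨h, hc, hv, _, _, hl', hk, hb⟩
  | viewChange h hc hv =>
    obtain ⟨rfl, rfl⟩ := List.append_singleton_inj.1 hL
    exact ⟨h, hc, rfl, hv⟩
  | newViewEmpty h hc hr hv hno hcard hnd hV hvouch =>
    obtain ⟨rfl, rfl⟩ := List.append_singleton_inj.1 hL
    exact ⟨h, hc, hr, hv, hno, ⟨hcard, hnd, hV⟩, .inl ⟨rfl, hvouch⟩⟩
  | newView h hc hr hv hno hcard hnd hV hvouch hmax hl' hk =>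
    obtain ⟨rfl, rfl⟩ := List.append_singleton_inj.1 hL
    exact ⟨h, hc, hr, hv, hno, ⟨hcard, hnd, hV⟩, .inr ⟨_, _, _, ⟨hvouch, hmax⟩, hl', hk, rfl⟩⟩

theorem Accepted.of_prefix (h : Accepted f K r l) (hl : l' <+: l) : Accepted f K r l' := by
  induction l using List.reverseRecOn with
  | nil => rwa [List.prefix_nil.1 hl]
  | append_singleton l b ih =>
    rcases List.prefix_concat_iff.1 hl with rfl | hl
    · exact h
    · exact ih (accepted_append_singleton.1 h).1 hl

theorem Accepted.init (h : Accepted f K r (l ++ [b])) : Accepted f K r l :=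
  (accepted_append_singleton.1 h).1

theorem Accepted.valid (h : Accepted f K r (l ++ [b])) : Valid f K r l b :=
  (accepted_append_singleton.1 h).2.2

theorem Accepted.certified_mem (h : Accepted f K r l) (hk : l[k]? = some b) :
    .certified r k b ∈ K := by
  obtain ⟨l', hl', rfl⟩ := exists_append_prefix_of_getElem? hk
  exact (accepted_append_singleton.1 (h.of_prefix hl')).2.1

/-- No USIG certifies two messages with the same counter value. -/
def UniqueCertificates (K : Set (Msg N Client Op Res)) : Prop :=
  ∀ r k b b', .certified r k b ∈ K → .certified r k b' ∈ K → b = b'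

theorem Accepted.prefix_of_length_le (hU : UniqueCertificates K) (h : Accepted f K r l)
    (h' : Accepted f K r l') (hl : l.length ≤ l'.length) : l <+: l' := by
  rw [List.prefix_iff_getElem]
  exact ⟨hl, fun k hk => hU _ _ _ _ (h.certified_mem (List.getElem?_eq_getElem hk))
    (h'.certified_mem (List.getElem?_eq_getElem _))⟩

theorem Accepted.curView_mono (h : Accepted f K r l) (hl : l' <+: l) : curView l' ≤ curView l := by
  induction l using List.reverseRecOn with
  | nil => rw [List.prefix_nil.1 hl]
  | append_singleton l b ih =>
    rcases List.prefix_concat_iff.1 hl with rfl | hl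
    · exact le_rfl
    · refine (ih h.init hl).trans ?_
      cases b with
      | viewChange v O => simpa only [curView_append_singleton] using h.valid.2.le
      | _ => rw [curView_append_singleton]

theorem Accepted.exists_viewChange (h : Accepted f K r l) (hl : curView l ≠ 0) :
    ∃ O, O ++ [.viewChange (curView l) O] <+: l := by
  induction l using List.reverseRecOn with
  | nil => exact absurd rfl hl
  | append_singleton l b ih =>
    cases b with
    | viewChange v O =>
      obtain ⟨rfl, -⟩ := h.valid
      exact ⟨O, by simp only [curView_append_singleton, List.prefix_rfl]⟩
    | _ =>
      simp only [curView_append_singleton] at hl ⊢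
      exact (ih h.init hl).imp fun O hO => hO.trans (List.prefix_append _ _)

theorem Valid.of_isProposal (h : Valid f K r l b) (hb : IsProposal v b) :
    r = primary N v ∧ curView l = v := by
  rcases hb with ⟨m, rfl⟩ | ⟨V, S, rfl⟩
  · exact ⟨h.2.1, h.2.2.1⟩
  · exact ⟨h.1, h.2.1⟩

theorem exists_newViewCertificate {R : Finset (Fin N)} (hR : N ≤ R.card + f)
    (hV : ∀ r ∈ R, ∃ O, Accepted f K r (O ++ [.viewChange v O])) :
    ∃ V, NewViewCertificate f K v V := by
  choose! O hO using hV
  refine ⟨R.toList.map fun r => (r, O r), by simpa using hR, ?_, ?_⟩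
  · simpa [Function.comp_def] using R.nodup_toList
  · simpa using hO

theorem NewViewCertificate.mono (hK : K ⊆ K') (h : NewViewCertificate f K v V) :
    NewViewCertificate f K' v V :=
  ⟨h.card, h.nodup, fun e he => (h.accepted e he).mono hK⟩

theorem NewViewCertificate.view_pos (hf : f < N) (h : NewViewCertificate f K v V) : 0 < v := by
  obtain ⟨e, he⟩ := List.exists_mem_of_length_pos (show 0 < V.length by have := h.card; omega)
  exact (Nat.zero_le _).trans_lt (h.accepted e he).valid.2

theorem NewViewCertificate.exists_sender_mem (h : NewViewCertificate f K v V)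
    {Q : Finset (Fin N)} (hQ : f < Q.card) : ∃ e ∈ V, e.1 ∈ Q := by
  have hsenders : (V.map Prod.fst).toFinset.card = V.length := by
    rw [List.toFinset_card_of_nodup h.nodup, List.length_map]
  obtain ⟨r, hr, hrQ⟩ := exists_mem_mem_of_lt_card_add_card (Q := (V.map Prod.fst).toFinset)
    (R := Q) (by have := h.card; omega)
  obtain ⟨e, he, rfl⟩ := List.mem_map.1 (List.mem_toFinset.1 hr)
  exact ⟨e, he, hrQ⟩

theorem CarriedOver.mono (hK : K ⊆ K') (h : CarriedOver f K V S) : CarriedOver f K' V S :=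
  h.imp_right fun ⟨w, k, l, hwk, hl, hlS⟩ => ⟨w, k, l, hwk, hl.mono hK, hlS⟩

theorem Accepted.exists_newView_mem (h : Accepted f K r l) (hv : 0 < v)
    (hl : ∃ b ∈ l, IsProposal v b) : ∃ V S, Body.newView v V S ∈ l := by
  obtain ⟨b, hb, ⟨m, rfl⟩ | ⟨V, S, rfl⟩⟩ := hl
  · obtain ⟨l', hl'⟩ := exists_append_prefix_of_mem hb
    obtain ⟨V, S, hVS⟩ := (h.of_prefix hl').valid.2.2.2.resolve_left hv.ne'
    exact ⟨V, S, ((List.prefix_append _ _).trans hl').subset hVS⟩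
  · exact ⟨V, S, hb⟩

theorem Accepted.histOf_prefix (hf : f < N) (h : Accepted f K r l) (hl : l' <+: l)
    (hopen : ∃ b ∈ l', IsProposal v b) : histOf v l' <+: histOf v l := by
  induction l using List.reverseRecOn with
  | nil => rw [List.prefix_nil.1 hl]
  | append_singleton l b ih =>
    rcases List.prefix_concat_iff.1 hl with rfl | hl₀
    · exact List.prefix_rfl
    refine (ih h.init hl₀).trans ?_
    by_cases hp : IsProposal v b
    · rcases hp with ⟨m, rfl⟩ | ⟨V, S, rfl⟩
      · simp [histOf_append_singleton]
      · obtain ⟨-, -, hno, hV, -⟩ := h.valid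
        exact absurd (h.init.exists_newView_mem (hV.view_pos hf)
          (hopen.imp fun _ hb => hb.imp_left (hl₀.subset ·))) hno
    · rw [histOf_append_of_not_isProposal hp]

theorem Accepted.request_mem (h : Accepted f K r l) {m : Command Client Op}
    (hm : m ∈ histOf v l) : .request m ∈ K := by
  induction h generalizing v m with
  | nil => simp [histOf] at hm
  | prepare _ _ hreq _ _ _ ih =>
    simp only [histOf_append_singleton] at hm
    split_ifs at hm
    · rcases List.mem_append.1 hm with hm | hm
      · exact ih hm
      · rwa [List.mem_singleton.1 hm]
    · exact ih hm
  | commit _ _ _ _ _ _ ih => exact ih (by simpa only [histOf_append_singleton] using hm)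
  | viewChange _ _ _ ih => exact ih (by simpa only [histOf_append_singleton] using hm)
  | newViewEmpty _ _ _ _ _ _ _ _ _ ih =>
    simp only [histOf_append_singleton] at hm
    split_ifs at hm
    · simp at hm
    · exact ih hm
  | newView _ _ _ _ _ _ _ _ _ _ _ _ ih _ ih' =>
    simp only [histOf_append_singleton] at hm
    split_ifs at hm
    · exact ih' hm
    · exact ih hm

theorem Accepted.of_vouches (h : Accepted f K r l) (hV : Vouches l w k) :
    w ≤ curView l ∧ ∃ l' b, Accepted f K (primary N w) (l' ++ [b]) ∧ l'.length = k ∧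
      IsProposal w b := by
  rcases hV with hc | ⟨b, hb, hp⟩
  · obtain ⟨l', hl'⟩ := exists_append_prefix_of_mem hc
    obtain ⟨rfl, hcommitted⟩ := (h.of_prefix hl').valid
    exact ⟨h.curView_mono ((List.prefix_append _ _).trans hl'), hcommitted⟩
  · obtain ⟨l', hl', rfl⟩ := exists_append_prefix_of_getElem? hb
    obtain ⟨rfl, rfl⟩ := (h.of_prefix hl').valid.of_isProposal hp
    exact ⟨h.curView_mono ((List.prefix_append _ _).trans hl'), l', b, h.of_prefix hl', rfl, hp⟩

theorem NewViewCertificate.of_vouches (hV : NewViewCertificate f K v V)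
    (h : ∃ e ∈ V, Vouches e.2 w k) :
    w < v ∧ ∃ l b, Accepted f K (primary N w) (l ++ [b]) ∧ l.length = k ∧ IsProposal w b := by
  obtain ⟨e, he, hwk⟩ := h
  exact ((hV.accepted e he).init.of_vouches hwk).imp_left
    fun hw => hw.trans_lt (hV.accepted e he).valid.2

theorem NewViewCertificate.exists_carriedOver (h : NewViewCertificate f K v V) :
    ∃ S, CarriedOver f K V S := by
  by_cases hvouch : ∃ e ∈ V, ∃ w k, Vouches e.2 w k
  · obtain ⟨w, k, hwk⟩ := exists_isLatestVouched hvouch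
    obtain ⟨-, l, b, hl, hk, -⟩ := h.of_vouches hwk.1
    exact ⟨_, .inr ⟨w, k, l ++ [b], hwk, hl, by simp [hk], rfl⟩⟩
  · push Not at hvouch
    exact ⟨[], .inl ⟨rfl, hvouch⟩⟩

end Accepted

section Certificates

variable {N : ℕ} [NeZero N] {Client Op Res : Type*} {f : ℕ} {K K' : Set (Msg N Client Op Res)}
  {r : Fin N} {l l' O : List (Body N Client Op)} {b : Body N Client Op} {v w k : ℕ}
  {V : List (Fin N × List (Body N Client Op))} {S h h' : List (Command Client Op)}

theorem Accepted.newView_prefix_histOf (hf : f < N) (hl : Accepted f K r l)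
    (hV : .newView v V S ∈ l) : S <+: histOf v l := by
  obtain ⟨l', hl'⟩ := exists_append_prefix_of_mem hV
  have := hl.histOf_prefix (v := v) hf hl' ⟨_, List.mem_concat_self, .inr ⟨V, S, rfl⟩⟩
  simpa only [histOf_append_singleton, if_pos] using this

theorem Accepted.commit_mem_of_viewChange (hU : UniqueCertificates K)
    (hl : Accepted f K r (l ++ [.commit v k])) (hO : Accepted f K r (O ++ [.viewChange w O]))
    (hvw : v < w) : .commit v k ∈ O := by
  rcases le_or_gt (O ++ [Body.viewChange w O]).length (l ++ [Body.commit v k]).length with hle | hlt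
  · have hview := hl.curView_mono (hO.prefix_of_length_le hU hl hle)
    obtain ⟨rfl, -⟩ := hl.valid
    simp only [curView_append_singleton] at hview
    exact absurd hview hvw.not_ge
  · have hle : (l ++ [Body.commit v k]).length ≤ O.length := by
      simpa only [List.length_append, List.length_singleton, Nat.lt_add_one_iff] using hlt
    exact (hl.prefix_of_length_le hU hO.init hle).subset List.mem_concat_self

theorem Certificate.exists_commit_mem (hU : UniqueCertificates K) (hc : Certificate f K v k)
    (hV : NewViewCertificate f K w V) (hvw : v < w) : ∃ e ∈ V, Body.commit v k ∈ e.2 := by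
  obtain ⟨Q, hQ, hcommit⟩ := hc
  obtain ⟨e, he, heQ⟩ := hV.exists_sender_mem hQ
  obtain ⟨l, hl⟩ := hcommit e.1 heQ
  exact ⟨e, he, hl.commit_mem_of_viewChange hU (hV.accepted e he) hvw⟩

theorem Certificate.histOf_prefix (hU : UniqueCertificates K) (hf : f < N)
    (hl : Accepted f K (primary N v) (l ++ [b])) (hb : IsProposal v b)
    (hc : Certificate f K v l.length) (hvw : v < w) (hl' : Accepted f K (primary N w) l')
    (hopen : ∃ b ∈ l', IsProposal w b) : histOf v (l ++ [b]) <+: histOf w l' := by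
  induction w using Nat.strong_induction_on generalizing l' with
  | h w ih =>
    obtain ⟨V, S, hVS⟩ := hl'.exists_newView_mem (Nat.zero_lt_of_lt hvw) hopen
    refine List.IsPrefix.trans ?_ (hl'.newView_prefix_histOf hf hVS)
    obtain ⟨l₀, hl₀⟩ := exists_append_prefix_of_mem hVS
    obtain ⟨-, -, -, hV, hS⟩ := (hl'.of_prefix hl₀).valid
    obtain ⟨e, he, hcommit⟩ := hc.exists_commit_mem hU hV hvw
    rcases hS with ⟨-, hno⟩ | ⟨x, k, l₁, ⟨hx, hmax⟩, hl₁, hlen, rfl⟩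
    · exact absurd (.inl hcommit) (hno e he _ _)
    obtain ⟨hxw, l₂, b₂, hl₂, rfl, hb₂⟩ := hV.of_vouches hx
    rcases hmax e he _ _ (.inl hcommit) with hvx | ⟨rfl, hk⟩
    · have hpre := hl₂.prefix_of_length_le hU hl₁ (by simp [hlen])
      exact ih x hxw hvx hl₁ ⟨b₂, hpre.subset List.mem_concat_self, hb₂⟩
    · have hpre := hl.prefix_of_length_le hU hl₁ (by simpa [hlen] using hk)
      exact hl₁.histOf_prefix hf hpre ⟨b, List.mem_concat_self, hb⟩

theorem Certificate.mono (hK : K ⊆ K') (hc : Certificate f K v k) : Certificate f K' v k := by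
  obtain ⟨Q, hQ, hcommit⟩ := hc
  exact ⟨Q, hQ, fun r hr => (hcommit r hr).imp fun _ hl => hl.mono hK⟩

theorem Decided.mono (hK : K ⊆ K') (hd : Decided f K h) : Decided f K' h := by
  obtain ⟨v, l, b, hl, hb, hc, hh⟩ := hd
  exact ⟨v, l, b, hl.mono hK, hb, fun k b' hk hb' => (hc k b' hk hb').mono hK, hh⟩

theorem Decided.request_mem (hd : Decided f K h) {m : Command Client Op} (hm : m ∈ h) :
    .request m ∈ K := by
  obtain ⟨v, l, b, hl, -, -, rfl⟩ := hd
  exact hl.request_mem hm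

theorem Decided.prefix_or_prefix (hU : UniqueCertificates K) (hf : f < N) (hd : Decided f K h)
    (hd' : Decided f K h') : h <+: h' ∨ h' <+: h := by
  obtain ⟨v, l, b, hl, hb, hc, rfl⟩ := hd
  obtain ⟨v', l', b', hl', hb', hc', rfl⟩ := hd'
  have hopen : ∃ a ∈ l ++ [b], IsProposal v a := ⟨b, List.mem_concat_self, hb⟩
  have hopen' : ∃ a ∈ l' ++ [b'], IsProposal v' a := ⟨b', List.mem_concat_self, hb'⟩
  rcases lt_trichotomy v v' with hv | rfl | hv
  · exact .inl ((hc l.length b (by simp) hb).histOf_prefix hU hf hl hb hv hl' hopen')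
  · exact (le_total (l ++ [b]).length (l' ++ [b']).length).imp
      (fun hle => hl'.histOf_prefix hf (hl.prefix_of_length_le hU hl' hle) hopen)
      (fun hle => hl.histOf_prefix hf (hl'.prefix_of_length_le hU hl hle) hopen')
  · exact .inr ((hc' l'.length b' (by simp) hb').histOf_prefix hU hf hl' hb' hv hl hopen)

end Certificates

section States

variable {N : ℕ} {Client Op Res St : Type*} {svc : Service Op Res St}
  {K K' : Set (Msg N Client Op Res)} {q v t : ℕ}
  {s s' s'' : Replica N Client Op Res} {x : Msg N Client Op Res} {R : Finset (Fin N)}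
  {i : Fin N} {T : ℕ} {X : Execution N Client Op Res} {m : Command Client Op}
  {h h' : List (Command Client Op)}

/-- According to the messages `K`, as many as `q` replicas request a change to view `v`. -/
def RequestQuorum (q : ℕ) (K : Set (Msg N Client Op Res)) (v : ℕ) : Prop :=
  ∃ Q : Finset (Fin N), q ≤ Q.card ∧ ∀ r ∈ Q, ∃ w, .reqViewChange r w v ∈ K

theorem RequestQuorum.mono (hK : K ⊆ K') (h : RequestQuorum q K v) : RequestQuorum q K' v := by
  obtain ⟨Q, hQ, hreq⟩ := h
  exact ⟨Q, hQ, fun r hr => (hreq r hr).imp fun _ hw => hK hw⟩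

theorem RequestQuorum.exists_mem (h : RequestQuorum q K v) (hR : N < q + R.card) :
    ∃ r ∈ R, ∃ w, .reqViewChange r w v ∈ K := by
  obtain ⟨Q, hQ, hreq⟩ := h
  obtain ⟨r, hrQ, hrR⟩ := exists_mem_mem_of_lt_card_add_card (Q := Q) (R := R) (by omega)
  exact ⟨r, hrR, hreq r hrQ⟩

namespace Replica

theorem msgs_hold (s : Replica N Client Op Res) (t : ℕ) (x : Msg N Client Op Res) :
    (s.hold t x).msgs = insert x s.msgs := by
  ext y
  simp only [msgs, hold, List.mem_append, List.mem_singleton, Prod.mk.injEq, Set.mem_ofPred_eq,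
    Set.mem_insert_iff, exists_or, exists_eq_left, or_comm]

theorem msgs_issue (s : Replica N Client Op Res) (i : Fin N) (t : ℕ) (b : Body N Client Op) :
    (s.issue i t b).msgs = insert (.certified i s.own.length b) s.msgs :=
  msgs_hold s t _

theorem mem_msgs_receive {inbox : List (Msg N Client Op Res)} :
    x ∈ (s.receive t inbox).msgs ↔ x ∈ s.msgs ∨ x ∈ inbox := by
  simp [msgs, receive, exists_or]

/-- A replica in state `s` may be in state `s'` later. -/
structure Le (s s' : Replica N Client Op Res) : Prop where
  held : s.held ⊆ s'.held
  hist : s.hist <+: s'.hist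
  view : s.view ≤ s'.view
  since : s.view = s'.view → s.since = s'.since

theorem Le.refl (s : Replica N Client Op Res) : s.Le s :=
  ⟨List.Subset.refl _, List.prefix_rfl, le_rfl, fun _ => rfl⟩

theorem Le.trans (h : s.Le s') (h' : s'.Le s'') : s.Le s'' where
  held := List.Subset.trans h.held h'.held
  hist := h.hist.trans h'.hist
  view := h.view.trans h'.view
  since hv :=
    have hv' : s.view = s'.view := le_antisymm h.view (hv ▸ h'.view)
    (h.since hv').trans (h'.since (hv'.symm.trans hv))

theorem Le.msgs_subset (h : s.Le s') : s.msgs ⊆ s'.msgs :=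
  fun _ ⟨t, hx⟩ => ⟨t, h.held hx⟩

theorem le_receive (s : Replica N Client Op Res) (t : ℕ) (inbox : List (Msg N Client Op Res)) :
    s.Le (s.receive t inbox) :=
  ⟨List.subset_append_left _ _, List.prefix_rfl, le_rfl, fun _ => rfl⟩

theorem le_hold (s : Replica N Client Op Res) (t : ℕ) (x : Msg N Client Op Res) :
    s.Le (s.hold t x) :=
  ⟨List.subset_append_left _ _, List.prefix_rfl, le_rfl, fun _ => rfl⟩

theorem le_issue (s : Replica N Client Op Res) (i : Fin N) (t : ℕ) (b : Body N Client Op) :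
    s.Le (s.issue i t b) :=
  ⟨List.subset_append_left _ _, List.prefix_rfl, le_rfl, fun _ => rfl⟩

end Replica

/-- State `s` may be reached before any of the replicas `R` has been in view `v` for long: it is
not beyond view `v`, it has not entered view `v` before tick `T`, and none of the replicas `R` is
known to request a change to a view beyond `v`. -/
structure Confined (T v : ℕ) (R : Finset (Fin N)) (s : Replica N Client Op Res) : Prop where
  view_le : s.view ≤ v
  le_since : s.view = v → T ≤ s.since
  request_le : ∀ r ∈ R, ∀ w v', .reqViewChange r w v' ∈ s.msgs → v' ≤ v

theorem Confined.hold (hs : Confined T v R s)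
    (hx : ∀ r ∈ R, ∀ w v', x = .reqViewChange r w v' → v' ≤ v) : Confined T v R (s.hold t x) where
  view_le := hs.view_le
  le_since := hs.le_since
  request_le r hr w v' hy := by
    rw [Replica.msgs_hold] at hy
    exact hy.elim (fun he => hx r hr w v' he.symm) (hs.request_le r hr w v')

theorem Confined.issue (hs : Confined T v R s) (i : Fin N) (b : Body N Client Op) :
    Confined T v R (s.issue i t b) :=
  have hs' : Confined T v R (s.hold t (.certified i s.own.length b)) := hs.hold nofun
  ⟨hs'.view_le, hs'.le_since, hs'.request_le⟩

/-- The messages that correct replicas ever hold. -/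
def Known (X : Execution N Client Op Res) (R : Finset (Fin N)) : Set (Msg N Client Op Res) :=
  {x | ∃ t, ∃ i ∈ R, x ∈ (X.replica t i).msgs}

theorem msgs_subset_known (hi : i ∈ R) : (X.replica t i).msgs ⊆ Known X R :=
  fun _ hx => ⟨t, i, hi, hx⟩

theorem Executes.of_prefix {res : Res} (he : Executes svc h m res) (hh : h <+: h') :
    Executes svc h' m res := by
  obtain ⟨h₁, h₂, rfl, hstale, hres⟩ := he
  obtain ⟨h₃, rfl⟩ := hh
  exact ⟨h₁, h₂ ++ h₃, by simp, hstale, hres⟩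

/-- According to the messages `K`, the command `m` is the latest request of its client. -/
def IsLatest (K : Set (Msg N Client Op Res)) (m : Command Client Op) : Prop :=
  ∀ m', .request m' ∈ K → m'.client = m.client → m.id ≤ m'.id → m' = m

theorem IsLatest.mem_of_stale (hm : IsLatest K m)
    (hK : ∀ m' ∈ h, .request m' ∈ K) (hstale : Stale h m) : m ∈ h := by
  obtain ⟨m', hm', hc, hid⟩ := hstale
  exact hm m' (hK m' hm') hc hid ▸ hm'

theorem IsLatest.exists_executes (hm : IsLatest K m)
    (hK : ∀ m' ∈ h, .request m' ∈ K) (hmem : m ∈ h) : ∃ res, Executes svc h m res := by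
  obtain ⟨h₁, h₂, rfl, hfirst⟩ := List.eq_append_cons_of_mem hmem
  exact ⟨_, h₁, h₂, rfl, fun hstale => hfirst
    (hm.mem_of_stale (fun m' hm' => hK m' (List.mem_append_left _ hm')) hstale), rfl⟩

end States

section Actions

variable {N : ℕ} [NeZero N] {Client Op Res St : Type*} {P : Params} {svc : Service Op Res St}
  {i : Fin N} {t : ℕ} {s s' : Replica N Client Op Res} {x : Msg N Client Op Res}
  {b : Body N Client Op}

namespace Replica

/-- The invariant of the states `s` of a correct replica `i`. -/
structure Inv (P : Params) (i : Fin N) (s : Replica N Client Op Res) : Prop where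
  certified : ∀ k b, .certified i k b ∈ s.msgs → s.own[k]? = some b
  own : Accepted P.f s.msgs i s.own
  view : curView s.own = s.view
  entered : s.view ≠ 0 → RequestQuorum P.q s.msgs s.view
  requested : ∀ w v, .reqViewChange i w v ∈ s.msgs → v ≤ s.view + 1
  hist : s.hist = [] ∨ Decided P.f s.msgs s.hist

theorem inv_initial : (initial : Replica N Client Op Res).Inv P i where
  certified := by simp [msgs, initial]
  own := .nil i
  view := rfl
  entered hv := absurd rfl hv
  requested := by simp [msgs, initial]
  hist := .inl rfl

theorem Inv.request_mem (h : s.Inv P i) {m : Command Client Op} (hm : m ∈ s.hist) :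
    .request m ∈ s.msgs :=
  (h.hist.resolve_left (List.ne_nil_of_mem hm)).request_mem hm

theorem Inv.mayIssue (h : s.Inv P i)
    (hb : Valid P.f (insert (.certified i s.own.length b) s.msgs) i s.own b) :
    s.MayIssue P.f i b :=
  (h.own.mono (Set.subset_insert _ _)).append_singleton (Set.mem_insert _ _) hb

theorem Inv.receive (h : s.Inv P i) {inbox : List (Msg N Client Op Res)}
    (hin : ∀ x ∈ inbox, x.author = some i → x ∈ s.msgs) : (s.receive t inbox).Inv P i := by
  have hle := (s.le_receive t inbox).msgs_subset
  have hmem : ∀ x ∈ (s.receive t inbox).msgs, x.author = some i → x ∈ s.msgs := fun x hx hi =>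
    (mem_msgs_receive.1 hx).elim id fun hx => hin x hx hi
  exact {
    certified := fun k b hx => h.certified k b (hmem _ hx rfl)
    own := h.own.mono hle
    view := h.view
    entered := fun hv => (h.entered hv).mono hle
    requested := fun w v hx => h.requested w v (hmem _ hx rfl)
    hist := h.hist.imp_right (Decided.mono hle) }

theorem Inv.hold (h : s.Inv P i) (hcert : ∀ r k b, x ≠ .certified r k b)
    (hreq : ∀ w v, x = .reqViewChange i w v → v ≤ s.view + 1) : (s.hold t x).Inv P i := by
  have hle := (s.le_hold t x).msgs_subset
  exact {
    certified := fun k b hx => by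
      rw [msgs_hold] at hx
      exact h.certified k b (hx.resolve_left fun he => hcert _ _ _ he.symm)
    own := h.own.mono hle
    view := h.view
    entered := fun hv => (h.entered hv).mono hle
    requested := fun w v hx => by
      rw [msgs_hold] at hx
      exact hx.elim (fun he => hreq w v he.symm) (h.requested w v)
    hist := h.hist.imp_right (Decided.mono hle) }

theorem Inv.issue_enter (h : s.Inv P i) (hb : s.MayIssue P.f i b) {v : ℕ}
    (hv : curView (s.own ++ [b]) = v) (hle : s.view ≤ v)
    (hreq : v ≠ s.view → RequestQuorum P.q s.msgs v) (t' : ℕ) :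
    { s.issue i t b with view := v, since := t' : Replica N Client Op Res }.Inv P i := by
  have hsub := (s.le_issue i t b).msgs_subset
  exact {
    certified := fun k b' hx => by
      change Msg.certified i k b' ∈ (s.issue i t b).msgs at hx
      change (s.own ++ [b])[k]? = some b'
      rw [msgs_issue] at hx
      rcases hx with he | hx
      · injection he with _ hk hb
        rw [hk, hb, List.getElem?_concat_length]
      · have hk := h.certified k b' hx
        rwa [List.getElem?_append_left (List.getElem?_eq_some_iff.1 hk).1]
    own := msgs_issue s i t b ▸ hb
    view := hv
    entered := fun hv₀ => by
      by_cases hvs : v = s.view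
      · exact (hvs ▸ h.entered (hvs ▸ hv₀)).mono hsub
      · exact (hreq hvs).mono hsub
    requested := fun w v' hx => by
      change Msg.reqViewChange i w v' ∈ (s.issue i t b).msgs at hx
      rw [msgs_issue] at hx
      exact (h.requested w v' (hx.resolve_left nofun)).trans (Nat.succ_le_succ hle)
    hist := h.hist.imp_right (Decided.mono hsub) }

theorem Inv.issue (h : s.Inv P i) (hb : s.MayIssue P.f i b)
    (hv : curView (s.own ++ [b]) = curView s.own) : (s.issue i t b).Inv P i :=
  h.issue_enter hb (hv.trans h.view) le_rfl (fun hne => absurd rfl hne) s.since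

end Replica

open Replica

theorem Act.le (h : Act P svc i t s s') : s.Le s' := by
  cases h with
  | prepare => exact s.le_issue _ _ _
  | commit => exact s.le_issue _ _ _
  | execute h _ hp _ => exact ⟨List.Subset.refl _, hp, le_rfl, fun _ => rfl⟩
  | reply => exact s.le_hold _ _
  | timeout => exact s.le_hold _ _
  | enterView v Q hv _ _ =>
    exact ⟨(s.le_issue _ _ _).held, List.prefix_rfl, hv.le, fun he => absurd he hv.ne⟩
  | newView => exact s.le_issue _ _ _

theorem Act.mem_msgs_or_author_eq (h : Act P svc i t s s') (hx : x ∈ s'.msgs) :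
    x ∈ s.msgs ∨ x.author = some i := by
  have hhold : ∀ y : Msg N Client Op Res, y.author = some i → x ∈ (s.hold t y).msgs →
      x ∈ s.msgs ∨ x.author = some i := by
    intro y hy hx
    rw [msgs_hold] at hx
    rcases hx with rfl | hx
    · exact .inr hy
    · exact .inl hx
  cases h with
  | execute => exact .inl hx
  | _ => exact hhold _ rfl hx

theorem Act.inv (h : Act P svc i t s s') (hs : s.Inv P i) : s'.Inv P i := by
  cases h with
  | prepare _ _ _ hb => exact hs.issue hb (curView_append_singleton _ _)
  | commit _ _ hb => exact hs.issue hb (curView_append_singleton _ _)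
  | execute h hd _ _ => exact { hs with hist := .inr hd }
  | reply => exact hs.hold nofun nofun
  | timeout => exact hs.hold nofun (by rintro _ _ ⟨⟩; rfl)
  | enterView v Q hv hQ hreq =>
    have hb : s.MayIssue P.f i (.viewChange v s.own) := hs.mayIssue ⟨rfl, hs.view ▸ hv⟩
    exact hs.issue_enter hb (curView_append_singleton _ _) hv.le (fun _ => ⟨Q, hQ, hreq⟩) t
  | newView V S hb => exact hs.issue hb (curView_append_singleton _ _)

/-- At tick `t` replica `i` has nothing left to do in state `s`. -/
def Quiet (P : Params) (svc : Service Op Res St) (i : Fin N) (t : ℕ)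
    (s : Replica N Client Op Res) : Prop :=
  ∀ s', ¬ Act P svc i t s s'

theorem Quiet.commit_mem (h : Quiet P svc i t s) (hs : s.Inv P i) {l : List (Body N Client Op)}
    (hl : Accepted P.f s.msgs (primary N s.view) (l ++ [b])) (hb : IsProposal s.view b) :
    Body.commit s.view l.length ∈ s.own := by
  by_contra hc
  exact h _ (.commit s _ hc
    (hs.mayIssue ⟨hs.view, l, b, hl.mono (Set.subset_insert _ _), rfl, hb⟩))

theorem Quiet.stale (h : Quiet P svc i t s) (hs : s.Inv P i) (hi : i = primary N s.view)
    (hopen : ∃ V S, Body.newView s.view V S ∈ s.own) {m : Command Client Op}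
    (hm : .request m ∈ s.msgs) : Stale (histOf s.view s.own) m := by
  by_contra hstale
  exact h _ (.prepare s m hm hstale
    (hs.mayIssue ⟨Set.mem_insert_of_mem _ hm, hi, hs.view, .inr hopen⟩))

theorem Quiet.newView_mem (h : Quiet P svc i t s) (hs : s.Inv P i) (hi : i = primary N s.view)
    {R : Finset (Fin N)} (hR : N ≤ R.card + P.f)
    (hV : ∀ r ∈ R, ∃ O, Accepted P.f s.msgs r (O ++ [.viewChange s.view O])) :
    ∃ V S, Body.newView s.view V S ∈ s.own := by
  by_contra hno
  obtain ⟨V, hV⟩ := exists_newViewCertificate hR hV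
  obtain ⟨S, hS⟩ := hV.exists_carriedOver
  exact h _ (.newView s V S (hs.mayIssue
    ⟨hi, hs.view, hno, hV.mono (Set.subset_insert _ _), hS.mono (Set.subset_insert _ _)⟩))

theorem Quiet.le_view (h : Quiet P svc i t s) {v : ℕ} (hreq : RequestQuorum P.q s.msgs v) :
    v ≤ s.view := by
  obtain ⟨Q, hQ, hreq⟩ := hreq
  by_contra! hlt
  exact h _ (.enterView s v Q hlt hQ hreq)

theorem Quiet.reply_mem (h : Quiet P svc i t s) {m : Command Client Op} {res : Res}
    (hm : Executes svc s.hist m res) : .reply i m.client m.id res ∈ s.msgs := by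
  by_contra hno
  exact h _ (.reply s m res hm hno)

theorem Quiet.reqViewChange_mem (h : Quiet P svc i t s) {t₀ : ℕ} {m : Command Client Op}
    (hs : s.since + P.timeout s.view ≤ t) (hm : (t₀, .request m) ∈ s.held)
    (ht : t₀ + P.timeout s.view ≤ t) (hstale : ¬ Stale s.hist m) :
    .reqViewChange i s.view (s.view + 1) ∈ s.msgs := by
  by_contra hno
  exact h _ (.timeout s hs (.inr ⟨t₀, m, hm, ht, hstale⟩) hno)

end Actions

section Runs

variable {N : ℕ} [NeZero N] {Client Op Res St : Type*} {P : Params} {svc : Service Op Res St}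
  {X : Execution N Client Op Res} {R : Finset (Fin N)} {C : Set Client} {i j : Fin N}
  {s s' : Replica N Client Op Res} {x : Msg N Client Op Res} {t t' T v : ℕ}

open Replica

theorem CorrectReplica.tick_induction (h : CorrectReplica P svc X i)
    {p : Replica N Client Op Res → Prop} (hreceive : p ((X.replica t i).receive t (X.inbox t i)))
    (hact : ∀ s s', p s → Act P svc i t s s' → p s') : p (X.replica (t + 1) i) := by
  have hticks := (h.2 t).1
  generalize X.replica (t + 1) i = s at hticks ⊢
  induction hticks with
  | refl => exact hreceive
  | tail _ ha ih => exact hact _ _ ih ha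

theorem CorrectReplica.quiet (h : CorrectReplica P svc X i) (ht : 0 < t) :
    Quiet P svc i (t - 1) (X.replica t i) := by
  obtain ⟨t, rfl⟩ := Nat.exists_eq_succ_of_ne_zero ht.ne'
  exact (h.2 t).2

theorem CorrectReplica.le (h : CorrectReplica P svc X i) (ht : t ≤ t') :
    (X.replica t i).Le (X.replica t' i) := by
  induction t', ht using Nat.le_induction with
  | base => exact .refl _
  | succ t' _ ih =>
    exact h.tick_induction (p := (X.replica t i).Le) (ih.trans (le_receive _ _ _))
      fun _ _ hs ha => hs.trans ha.le

theorem CorrectReplica.mem_msgs_of_mem_inbox (h : CorrectReplica P svc X i)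
    (hx : x ∈ X.inbox t i) : x ∈ (X.replica (t + 1) i).msgs :=
  h.tick_induction (p := fun s => x ∈ s.msgs) (mem_msgs_receive.2 (.inr hx))
    fun _ _ hs ha => ha.le.msgs_subset hs

theorem CorrectReplica.exists_mem_inbox (h : CorrectReplica P svc X i)
    (hx : x ∈ (X.replica t i).msgs) (hi : x.author ≠ some i) : ∃ t' < t, x ∈ X.inbox t' i := by
  induction t with
  | zero => simp [h.1, msgs, initial] at hx
  | succ t ih =>
    revert hx
    refine h.tick_induction (p := fun s => x ∈ s.msgs → ∃ t' < t + 1, x ∈ X.inbox t' i)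
      (fun hx => ?_) fun s s' hs ha hx => hs ((ha.mem_msgs_or_author_eq hx).resolve_right hi)
    rcases mem_msgs_receive.1 hx with hx | hx
    · obtain ⟨t', ht', hx⟩ := ih hx
      exact ⟨t', ht'.trans t.lt_succ_self, hx⟩
    · exact ⟨t, t.lt_succ_self, hx⟩

theorem CorrectReplica.eventually_mem_msgs (h : CorrectReplica P svc X i)
    (hx : x ∈ (X.replica t i).msgs) : ∀ᶠ t' in atTop, x ∈ (X.replica t' i).msgs :=
  (eventually_ge_atTop t).mono fun _ ht => (h.le ht).msgs_subset hx

/-- A run in which the replicas `R` follow the protocol, and in which no signatures of these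
replicas and of the clients `C` and no certificates are forged. -/
structure CorrectRun (P : Params) (svc : Service Op Res St) (X : Execution N Client Op Res)
    (R : Finset (Fin N)) (C : Set Client) : Prop where
  replica : ∀ i ∈ R, CorrectReplica P svc X i
  auth : Authentic X R C

theorem Act.confined (h : Act P svc i t s s') (hR : N < P.q + R.card) (hT : T ≤ t)
    (ht : t < T + P.timeout v) (hs : Confined T v R s) : Confined T v R s' := by
  cases h with
  | execute => exact { hs with }
  | timeout hexp _ _ =>
    refine hs.hold ?_
    rintro r - w v' ⟨⟩
    refine lt_of_le_of_ne hs.view_le fun hv => ?_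
    have hsince := hs.le_since hv
    rw [hv] at hexp
    omega
  | enterView v' Q hv hQ hreq =>
    obtain ⟨r, hr, w, hw⟩ := RequestQuorum.exists_mem ⟨Q, hQ, hreq⟩ hR
    exact ⟨hs.request_le r hr w v' hw, fun _ => hT, (hs.issue i _).request_le⟩
  | prepare => exact hs.issue i _
  | commit => exact hs.issue i _
  | reply => exact hs.hold nofun
  | newView => exact hs.issue i _

namespace CorrectRun

variable (H : CorrectRun P svc X R C)
include H

theorem inv (hi : i ∈ R) (t : ℕ) : (X.replica t i).Inv P i := by
  induction t with
  | zero => exact (H.replica i hi).1 ▸ inv_initial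
  | succ t ih =>
    exact (H.replica i hi).tick_induction
      (ih.receive fun x hx ha => H.auth.replica t i hi x hx i hi ha) fun _ _ hs ha => ha.inv hs

theorem mem_msgs_author (hi : i ∈ R) (hj : j ∈ R) (hx : x ∈ (X.replica t j).msgs)
    (ha : x.author = some i) : x ∈ (X.replica t i).msgs := by
  by_cases hij : x.author = some j
  · obtain rfl : i = j := Option.some.inj (ha.symm.trans hij)
    exact hx
  · obtain ⟨t', ht', hx⟩ := (H.replica j hj).exists_mem_inbox hx hij
    exact ((H.replica i hi).le ht'.le).msgs_subset (H.auth.replica t' j hj x hx i hi ha)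

theorem uniqueCertificates : UniqueCertificates (Known X R) := by
  rintro r k b b' ⟨t, i, hi, hx⟩ ⟨t', j, hj, hx'⟩
  by_cases hr : r ∈ R
  · have hown : ∀ {t b i}, i ∈ R → Msg.certified r k b ∈ (X.replica t i).msgs →
        ∀ᶠ t in atTop, (X.replica t r).own[k]? = some b := fun hi hx =>
      ((H.replica r hr).eventually_mem_msgs (H.mem_msgs_author hr hi hx rfl)).mono fun t hx =>
        (H.inv hr t).certified k _ hx
    obtain ⟨t, hb, hb'⟩ := ((hown hi hx).and (hown hj hx')).exists
    exact Option.some.inj (hb.symm.trans hb')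
  · have hreceived : ∀ {t b i}, i ∈ R → Msg.certified r k b ∈ (X.replica t i).msgs →
        ∃ t, Msg.certified r k b ∈ X.inbox t i := by
      intro t b i hi hx
      obtain ⟨t', -, hx⟩ := (H.replica i hi).exists_mem_inbox hx
        fun ha => hr (Option.some.inj ha ▸ hi)
      exact ⟨t', hx⟩
    obtain ⟨_, hx⟩ := hreceived hi hx
    obtain ⟨_, hx'⟩ := hreceived hj hx'
    exact H.auth.usig _ _ i hi j hj r k b b' hx hx'

theorem exists_submits {m : Command Client Op} (hm : .request m ∈ Known X R) (hc : m.client ∈ C) :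
    ∃ t, X.submits t m := by
  obtain ⟨t, i, hi, hx⟩ := hm
  obtain ⟨t', -, hx⟩ := (H.replica i hi).exists_mem_inbox hx nofun
  obtain ⟨t, -, ht⟩ := H.auth.client t' i hi m hx hc
  exact ⟨t, ht⟩

theorem confined (hR : N < P.q + R.card) (hT : ∀ i ∈ R, (X.replica T i).view < v) (ht : T ≤ t)
    (ht' : t ≤ T + P.timeout v) : ∀ i ∈ R, Confined T v R (X.replica t i) := by
  induction t, ht using Nat.le_induction with
  | base =>
    refine fun i hi => ⟨(hT i hi).le, fun he => absurd he (hT i hi).ne, fun r hr w v' hx => ?_⟩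
    exact ((H.inv hr T).requested w v' (H.mem_msgs_author hr hi hx rfl)).trans (hT r hr)
  | succ t hTt ih =>
    intro i hi
    have ih := ih (Nat.le_of_succ_le ht')
    refine (H.replica i hi).tick_induction
      ⟨(ih i hi).view_le, (ih i hi).le_since, fun r hr w v' hx => ?_⟩
      fun _ _ hs ha => ha.confined hR hTt ht' hs
    rcases mem_msgs_receive.1 hx with hx | hx
    · exact (ih i hi).request_le r hr w v' hx
    · exact (ih r hr).request_le r hr w v' (H.auth.replica t i hi _ hx r hr rfl)

theorem prefix_hist (hf : P.f < N) (hi : i ∈ R) (ht : 0 < t) {h : List (Command Client Op)}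
    (hd : Decided P.f (X.replica t i).msgs h) : h <+: (X.replica t i).hist := by
  have hcomparable : (X.replica t i).hist <+: h ∨ h <+: (X.replica t i).hist := by
    rcases (H.inv hi t).hist with hnil | hd'
    · exact .inl (hnil ▸ List.nil_prefix)
    · exact (hd'.mono (msgs_subset_known hi)).prefix_or_prefix H.uniqueCertificates hf
        (hd.mono (msgs_subset_known hi))
  refine hcomparable.elim (fun hle => ?_) id
  by_contra hne
  exact (H.replica i hi).quiet ht _
    (.execute _ h hd hle fun he => hne (he ▸ List.prefix_rfl))

end CorrectRun

end Runs

section Liveness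

variable {N : ℕ} [NeZero N] {Client Op Res St : Type*} {P : Params} {svc : Service Op Res St}
  {X : Execution N Client Op Res} {R : Finset (Fin N)} {C : Set Client} {i j : Fin N}
  {m : Command Client Op} {b : Body N Client Op} {l : List (Body N Client Op)}
  {t T G D v k : ℕ}

open Replica

/-- From tick `G` on, what one of the replicas `R` holds reaches all of them within `D` ticks. -/
structure Delivers (X : Execution N Client Op Res) (R : Finset (Fin N)) (G D : ℕ) : Prop where
  pos : 0 < D
  msgs_subset : ∀ t ≥ G, ∀ i ∈ R, ∀ j ∈ R, (X.replica t i).msgs ⊆ (X.replica (t + D) j).msgs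

/-- From tick `t` to tick `t'` all the replicas `R` are in view `v`. -/
def StableView (X : Execution N Client Op Res) (R : Finset (Fin N)) (v t t' : ℕ) : Prop :=
  ∀ t₁, t ≤ t₁ → t₁ ≤ t' → ∀ i ∈ R, (X.replica t₁ i).view = v

theorem exists_primary_eq (r : Fin N) (n : ℕ) : ∃ v ≥ n, primary N v = r :=
  ⟨r + N * n, (Nat.le_mul_of_pos_left n (NeZero.pos N)).trans (Nat.le_add_left _ _),
    Fin.ext (by simp [primary, Fin.ofNat, Nat.mod_eq_of_lt r.isLt])⟩

theorem CorrectReplica.eventually_reqViewChange (hi : CorrectReplica P svc X i)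
    (hm : .request m ∈ (X.replica t i).msgs) (hno : ∀ t, ¬ Stale (X.replica t i).hist m)
    (hv : ∀ᶠ t in atTop, (X.replica t i).view = v) :
    ∀ᶠ t in atTop, .reqViewChange i v (v + 1) ∈ (X.replica t i).msgs := by
  obtain ⟨t₀, ht₀⟩ := hm
  obtain ⟨T, hT⟩ := hv.exists_forall_of_atTop
  filter_upwards [eventually_ge_atTop (max t T + t₀ + (X.replica T i).since + P.timeout v + 1)]
    with t' ht'
  have hview := hT t' (by omega)
  have hsince := (hi.le (show T ≤ t' by omega)).since (by rw [hT T le_rfl, hview])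
  have := (hi.quiet (show 0 < t' by omega)).reqViewChange_mem (by rw [hview]; omega)
    ((hi.le (show t ≤ t' by omega)).held ht₀) (by rw [hview]; omega) (hno t')
  rwa [hview] at this

namespace CorrectRun

variable (H : CorrectRun P svc X R C)
include H

theorem exists_delivers (hsync : PartiallySynchronous X R C) : ∃ G D, Delivers X R G D := by
  obtain ⟨GST, Δ, hmsg, -, -⟩ := hsync
  refine ⟨GST, Δ + 1, Nat.succ_pos Δ, fun t ht i hi j hj x hx => ?_⟩
  obtain ⟨t', ht', hx⟩ := hmsg t i hi x hx j hj
  rw [max_eq_left ht] at ht'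
  exact ((H.replica j hj).le (by omega)).msgs_subset ((H.replica j hj).mem_msgs_of_mem_inbox hx)

theorem exists_request_mem (hsync : PartiallySynchronous X R C) (hc : m.client ∈ C)
    (hm : X.submits t m) (hi : i ∈ R) : ∃ t, .request m ∈ (X.replica t i).msgs := by
  obtain ⟨GST, Δ, -, -, hreq⟩ := hsync
  obtain ⟨t', -, hx⟩ := hreq t m hc hm i hi
  exact ⟨t' + 1, (H.replica i hi).mem_msgs_of_mem_inbox hx⟩

theorem isLatest_of_not_completed (hclient : CorrectClient P.f X m.client) (hc : m.client ∈ C)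
    (hm : X.submits t m) (hno : ∀ t, ¬ Completed P.f X m t) : IsLatest (Known X R) m := by
  intro m' hm' hcm hid
  obtain ⟨t', ht'⟩ := H.exists_submits hm' (hcm ▸ hc)
  rcases lt_trichotomy t t' with hlt | rfl | hlt
  · exact absurd ((hclient t t' m m' rfl hcm hm ht').2 hlt).2 (hno t')
  · exact ((hclient t t m m' rfl hcm hm ht').1 rfl).symm
  · exact absurd ((hclient t' t m' m hcm rfl ht' hm).2 hlt).1 hid.not_gt

theorem request_mem_known (hi : i ∈ R) {m' : Command Client Op}
    (hm' : m' ∈ (X.replica t i).hist) : .request m' ∈ Known X R :=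
  msgs_subset_known hi ((H.inv hi t).request_mem hm')

theorem hist_prefix_hist (hf : P.f < N) (hD : Delivers X R G D) (ht : G ≤ t) (hi : i ∈ R)
    (hj : j ∈ R) : (X.replica t i).hist <+: (X.replica (t + D) j).hist := by
  rcases (H.inv hi t).hist with hnil | hd
  · exact hnil ▸ List.nil_prefix
  · exact H.prefix_hist hf hj (Nat.add_pos_right t hD.pos)
      (hd.mono (hD.msgs_subset t ht i hi j hj))

theorem exists_completed (hf : P.f < R.card) (hsync : PartiallySynchronous X R C)
    (hc : m.client ∈ C) (hlatest : IsLatest (Known X R) m) (hi : i ∈ R)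
    (hm : m ∈ (X.replica t i).hist) : ∃ t', Completed P.f X m t' := by
  obtain ⟨G, D, hD⟩ := H.exists_delivers hsync
  have hm : m ∈ (X.replica (max t G) i).hist :=
    ((H.replica i hi).le (le_max_left t G)).hist.subset hm
  obtain ⟨res, hres⟩ := hlatest.exists_executes (fun _ => H.request_mem_known hi) hm
  have hreply : ∀ j ∈ R, .reply j m.client m.id res ∈ (X.replica (max t G + D) j).msgs :=
    fun j hj => ((H.replica j hj).quiet (Nat.add_pos_right _ hD.pos)).reply_mem <|
      hres.of_prefix <| H.hist_prefix_hist (hf.trans_le (card_finset_fin_le R)) hD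
        (le_max_right t G) hi hj
  obtain ⟨GST, Δ, -, hdeliver, -⟩ := hsync
  exact ⟨max (max t G + D) GST + Δ, res, R, hf, fun j hj =>
    hdeliver _ j hj j m.client hc m.id res (hreply j hj)⟩

theorem view_le_of_delivers (hD : Delivers X R G D) (ht : G ≤ t) (hi : i ∈ R) (hj : j ∈ R) :
    (X.replica t i).view ≤ (X.replica (t + D) j).view := by
  by_cases hv : (X.replica t i).view = 0
  · exact hv ▸ Nat.zero_le _
  · exact ((H.replica j hj).quiet (Nat.add_pos_right t hD.pos)).le_view
      (((H.inv hi t).entered hv).mono (hD.msgs_subset t ht i hi j hj))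

theorem eventually_view_eq (hD : Delivers X R G D) (hi : i ∈ R) (hj : j ∈ R)
    (hmax : ∀ t', (X.replica t' j).view ≤ (X.replica t i).view) :
    ∀ᶠ t' in atTop, (X.replica t' j).view = (X.replica t i).view := by
  filter_upwards [eventually_ge_atTop (max t G + D)] with t' ht'
  refine (hmax t').antisymm ?_
  exact ((H.replica i hi).le (le_max_left t G)).view.trans <|
    (H.view_le_of_delivers hD (le_max_right t G) hi hj).trans ((H.replica j hj).le ht').view

theorem exists_view_gt (hq : P.q ≤ R.card) (hD : Delivers X R G D)
    (hm : ∀ i ∈ R, ∃ t, .request m ∈ (X.replica t i).msgs)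
    (hno : ∀ t, ∀ i ∈ R, ¬ Stale (X.replica t i).hist m) (hi : i ∈ R) :
    ∃ t', ∃ j ∈ R, (X.replica t i).view < (X.replica t' j).view := by
  by_contra! hmax
  have hreq : ∀ᶠ t' in atTop, ∀ j ∈ R,
      .reqViewChange j (X.replica t i).view ((X.replica t i).view + 1) ∈
        (X.replica t' j).msgs := by
    refine (eventually_all_finset R).2 fun j hj => ?_
    obtain ⟨t₀, ht₀⟩ := hm j hj
    exact (H.replica j hj).eventually_reqViewChange ht₀ (fun t => hno t j hj)
      (H.eventually_view_eq hD hi hj fun t' => hmax t' j hj)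
  obtain ⟨t', hreq, ht'⟩ := (hreq.and (eventually_ge_atTop G)).exists
  have hquorum : RequestQuorum P.q (X.replica (t' + D) i).msgs ((X.replica t i).view + 1) :=
    ⟨R, hq, fun j hj => ⟨_, hD.msgs_subset t' ht' j hj i hi (hreq j hj)⟩⟩
  exact (hmax (t' + D) i hi).not_gt
    (((H.replica i hi).quiet (Nat.add_pos_right t' hD.pos)).le_view hquorum)

theorem exists_le_view (hR : R.Nonempty) (hq : P.q ≤ R.card) (hD : Delivers X R G D)
    (hm : ∀ i ∈ R, ∃ t, .request m ∈ (X.replica t i).msgs)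
    (hno : ∀ t, ∀ i ∈ R, ¬ Stale (X.replica t i).hist m) (v : ℕ) :
    ∃ t, ∃ i ∈ R, v ≤ (X.replica t i).view := by
  induction v with
  | zero => exact ⟨0, hR.imp fun i hi => ⟨hi, Nat.zero_le _⟩⟩
  | succ v ih =>
    obtain ⟨t, i, hi, hv⟩ := ih
    obtain ⟨t', j, hj, hlt⟩ := H.exists_view_gt (t := t) hq hD hm hno hi
    exact ⟨t', j, hj, hv.trans_lt hlt⟩

theorem exists_first_entry (hT : ∀ i ∈ R, (X.replica T i).view < v)
    (hv : ∃ t, ∃ i ∈ R, v ≤ (X.replica t i).view) :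
    ∃ t ≥ T, (∀ i ∈ R, (X.replica t i).view < v) ∧ ∃ i ∈ R, v ≤ (X.replica (t + 1) i).view := by
  classical
  have hlt : T < Nat.find hv := by
    by_contra! hle
    obtain ⟨i, hi, hvi⟩ := Nat.find_spec hv
    exact (hT i hi).not_ge (hvi.trans ((H.replica i hi).le hle).view)
  obtain ⟨t, ht⟩ := Nat.exists_eq_succ_of_ne_zero (Nat.ne_zero_of_lt hlt)
  refine ⟨t, Nat.le_of_lt_succ (ht ▸ hlt), fun i hi => ?_, ?_⟩
  · have hmin := Nat.find_min hv (ht ▸ t.lt_succ_self)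
    exact lt_of_not_ge fun hle => hmin ⟨i, hi, hle⟩
  · have hentry := Nat.find_spec hv
    rwa [ht] at hentry

theorem stableView_of_first_entry (hq : N < P.q + R.card) (hD : Delivers X R G D) (ht : G ≤ t)
    (hlt : ∀ i ∈ R, (X.replica t i).view < v) (hi : i ∈ R)
    (hv : v ≤ (X.replica (t + 1) i).view) :
    StableView X R v (t + 1 + D) (t + P.timeout v) := by
  intro t₁ ht₁ ht₁' j hj
  refine (H.confined hq hlt (by omega) ht₁' j hj).view_le.antisymm (hv.trans ?_)
  exact (H.view_le_of_delivers hD (Nat.le_succ_of_le ht) hi hj).trans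
    ((H.replica j hj).le ht₁).view

theorem exists_stableView (hq : N < P.q + R.card) (htimeout : Tendsto P.timeout atTop atTop)
    (hD : Delivers X R G D) (hview : ∀ v, ∃ t, ∃ i ∈ R, v ≤ (X.replica t i).view) (r : Fin N)
    (T d : ℕ) : ∃ v t, 0 < v ∧ T ≤ t ∧ primary N v = r ∧ StableView X R v t (t + d) := by
  have hlate : ∀ᶠ v in atTop, ∀ i ∈ R, (X.replica (max T G) i).view < v :=
    (eventually_all_finset R).2 fun i _ => eventually_gt_atTop _
  obtain ⟨n, hn⟩ := ((htimeout.eventually_ge_atTop (1 + D + d)).and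
    (hlate.and (eventually_gt_atTop 0))).exists_forall_of_atTop
  obtain ⟨v, hnv, hr⟩ := exists_primary_eq r n
  obtain ⟨hlong, hbefore, hpos⟩ := hn v hnv
  obtain ⟨t, ht, hlt, i, hi, hv⟩ := H.exists_first_entry hbefore (hview v)
  refine ⟨v, t + 1 + D, hpos, by omega, hr, fun t₁ ht₁ ht₁' => ?_⟩
  exact H.stableView_of_first_entry hq hD (by omega) hlt hi hv t₁ ht₁ (by omega)

theorem newView_mem_of_stableView (hR : N ≤ R.card + P.f) (hD : Delivers X R G D) (ht : G ≤ t)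
    (hv : v ≠ 0) (hp : primary N v ∈ R) (hstable : StableView X R v t (t + D)) :
    ∃ V S, Body.newView v V S ∈ (X.replica (t + D) (primary N v)).own := by
  have hview := hstable (t + D) (Nat.le_add_right _ _) le_rfl _ hp
  have := ((H.replica _ hp).quiet (Nat.add_pos_right t hD.pos)).newView_mem
    (H.inv hp _) (by rw [hview]) hR fun r hr => ?_
  · rwa [hview] at this
  · have hr₀ := (H.inv hr t).view.trans (hstable t le_rfl (Nat.le_add_right _ _) r hr)
    obtain ⟨O, hO⟩ := (H.inv hr t).own.exists_viewChange (hr₀ ▸ hv)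
    rw [hr₀] at hO
    rw [hview]
    exact ⟨O, ((H.inv hr t).own.of_prefix hO).mono (hD.msgs_subset t ht r hr _ hp)⟩

theorem mem_histOf_own (hp : primary N v ∈ R) (ht : 0 < t)
    (hview : (X.replica t (primary N v)).view = v)
    (hopen : ∃ V S, Body.newView v V S ∈ (X.replica t (primary N v)).own)
    (hm : .request m ∈ (X.replica t (primary N v)).msgs) (hlatest : IsLatest (Known X R) m) :
    m ∈ histOf v (X.replica t (primary N v)).own := by
  have hstale := ((H.replica _ hp).quiet ht).stale (H.inv hp t) (by rw [hview])
    (by rwa [hview]) hm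
  rw [hview] at hstale
  exact hlatest.mem_of_stale
    (fun _ hm' => msgs_subset_known hp ((H.inv hp t).own.request_mem hm')) hstale

theorem commit_mem_own (hD : Delivers X R G D) (ht : G ≤ t) (hp : primary N v ∈ R) (hj : j ∈ R)
    (hview : (X.replica (t + D) j).view = v)
    (hl : l ++ [b] <+: (X.replica t (primary N v)).own) (hb : IsProposal v b) :
    Body.commit v l.length ∈ (X.replica (t + D) j).own := by
  subst hview
  exact ((H.replica j hj).quiet (Nat.add_pos_right t hD.pos)).commit_mem (H.inv hj _)
    (((H.inv hp t).own.of_prefix hl).mono (hD.msgs_subset t ht _ hp j hj)) hb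

theorem certificate_of_commit_mem (hf : P.f < R.card) (hD : Delivers X R G D) (ht : G ≤ t)
    (hc : ∀ i ∈ R, Body.commit v k ∈ (X.replica t i).own) (hj : j ∈ R) :
    Certificate P.f (X.replica (t + D) j).msgs v k :=
  ⟨R, hf, fun r hr => (exists_append_prefix_of_mem (hc r hr)).imp fun _ hl =>
    ((H.inv hr t).own.of_prefix hl).mono (hD.msgs_subset t ht r hr j hj)⟩

theorem decided_of_delivers (hf : P.f < R.card) (hD : Delivers X R G D) (ht : G ≤ t)
    (hp : primary N v ∈ R) (hview : ∀ j ∈ R, (X.replica (t + D) j).view = v)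
    (hopen : ∃ b ∈ (X.replica t (primary N v)).own, IsProposal v b) (hj : j ∈ R) :
    Decided P.f (X.replica (t + D + D) j).msgs
      (histOf v (X.replica t (primary N v)).own) := by
  obtain ⟨l, b, hl, hb, hhist⟩ := exists_last_proposal _ hopen
  have hmsgs : (X.replica t (primary N v)).msgs ⊆ (X.replica (t + D + D) j).msgs :=
    (hD.msgs_subset t ht _ hp j hj).trans
      ((H.replica j hj).le (Nat.le_add_right _ _)).msgs_subset
  refine ⟨v, l, b, ((H.inv hp t).own.of_prefix hl).mono hmsgs, hb, fun k b' hk hb' => ?_,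
    hhist.symm⟩
  obtain ⟨l', hl', rfl⟩ := exists_append_prefix_of_getElem? hk
  exact H.certificate_of_commit_mem hf hD (Nat.le_add_right_of_le ht)
    (fun i hi => H.commit_mem_own hD ht hp hi (hview i hi) (hl'.trans hl) hb') hj

theorem mem_hist_of_stableView (hf : P.f < R.card) (hR : N ≤ R.card + P.f)
    (hD : Delivers X R G D) (ht : G ≤ t) (hv : v ≠ 0) (hp : primary N v ∈ R)
    (hm : .request m ∈ (X.replica t (primary N v)).msgs) (hlatest : IsLatest (Known X R) m)
    (hstable : StableView X R v t (t + D + D)) (hj : j ∈ R) :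
    m ∈ (X.replica (t + D + D + D) j).hist := by
  obtain ⟨V, S, hVS⟩ := H.newView_mem_of_stableView hR hD ht hv hp
    fun t₁ h₁ h₂ => hstable t₁ h₁ (Nat.le_add_right_of_le h₂)
  have hproposed : m ∈ histOf v (X.replica (t + D) (primary N v)).own :=
    H.mem_histOf_own hp (Nat.add_pos_right t hD.pos) (hstable _ (by omega) (by omega) _ hp)
      ⟨V, S, hVS⟩ (((H.replica _ hp).le (Nat.le_add_right t D)).msgs_subset hm) hlatest
  have hdecided := H.decided_of_delivers hf hD (Nat.le_add_right_of_le ht) hp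
    (hstable _ (by omega) le_rfl) ⟨_, hVS, .inr ⟨V, S, rfl⟩⟩ hj
  exact (H.prefix_hist (hf.trans_le (card_finset_fin_le R)) hj
    (Nat.add_pos_right _ hD.pos) hdecided).subset hproposed

theorem exists_mem_hist (hf : P.f < R.card) (hR : N ≤ R.card + P.f) (hq : N < P.q + R.card)
    (hq' : P.q ≤ R.card) (htimeout : Tendsto P.timeout atTop atTop)
    (hsync : PartiallySynchronous X R C)
    (hm : ∀ i ∈ R, ∃ t, .request m ∈ (X.replica t i).msgs) (hlatest : IsLatest (Known X R) m) :
    ∃ t, ∃ i ∈ R, m ∈ (X.replica t i).hist := by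
  by_contra! hno
  have hstale : ∀ t, ∀ i ∈ R, ¬ Stale (X.replica t i).hist m := fun t i hi hstale =>
    hno t i hi (hlatest.mem_of_stale (fun _ => H.request_mem_known hi) hstale)
  obtain ⟨G, D, hD⟩ := H.exists_delivers hsync
  obtain ⟨r, hr⟩ : R.Nonempty := Finset.card_pos.1 (Nat.zero_lt_of_lt hf)
  obtain ⟨t₀, ht₀⟩ := hm r hr
  obtain ⟨v, t, hv, ht, rfl, hstable⟩ := H.exists_stableView hq htimeout hD
    (H.exists_le_view ⟨r, hr⟩ hq' hD hm hstale) r (max t₀ G) (D + D)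
  refine hno _ _ hr (H.mem_hist_of_stableView hf hR hD ((le_max_right _ _).trans ht) hv.ne' hr
    ?_ hlatest (by rwa [add_assoc]) hr)
  exact ((H.replica _ hr).le ((le_max_left _ _).trans ht)).msgs_subset ht₀

end CorrectRun

end Liveness

end FlexMinBFT

theorem mainTheorem4 {N : ℕ} [NeZero N] {Client Op Res St : Type*}
    (P : FlexMinBFT.Params) (svc : FlexMinBFT.Service Op Res St)
    (hN : 2 * P.f + 1 ≤ N) (hq : P.f + 1 ≤ P.q) (hq' : P.q + P.f ≤ N)
    (htimeout : Tendsto P.timeout atTop atTop)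
    (X : FlexMinBFT.Execution N Client Op Res)
    (R : Finset (Fin N)) (C : Set Client)
    (hR : N ≤ R.card + P.f)
    (hreplica : ∀ i ∈ R, FlexMinBFT.CorrectReplica P svc X i)
    (hclient : ∀ c ∈ C, FlexMinBFT.CorrectClient P.f X c)
    (hauth : FlexMinBFT.Authentic X R C)
    (hsync : FlexMinBFT.PartiallySynchronous X R C) :
    ∀ t m, m.client ∈ C → X.submits t m → ∃ t', FlexMinBFT.Completed P.f X m t' := by
  intro t m hc hm
  by_contra! hno
  have H : FlexMinBFT.CorrectRun P svc X R C := ⟨hreplica, hauth⟩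
  have hlatest := H.isLatest_of_not_completed (hclient _ hc) hc hm hno
  obtain ⟨_, i, hi, hexecuted⟩ := H.exists_mem_hist (by omega) hR (by omega) (by omega) htimeout
    hsync (fun i hi => H.exists_request_mem hsync hc hm hi) hlatest
  exact (H.exists_completed (by omega) hsync hc hlatest hi hexecuted).elim hno
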